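/- **Golden–Thompson inequality.** Let $A,B$ be complex Hermitian matrices of the same finite size. Then $\mathrm{tr}[\exp(A+B)]$ and $\mathrm{tr}[\exp(A)\exp(B)]$ are real numbers and $$\mathrm{tr}[\exp(A+B)] \le \mathrm{tr}[\exp(A)\exp(B)],$$ where $\exp$ is the matrix exponential. Moreover, if $A,B$ are complex Hermitian positive definite matrices of the same finite size, then $\mathrm{tr}[\exp(\log A+\log B)]$ and $\mathrm{tr}(AB)$ are real and $$\mathrm{tr}[\exp(\log A+\log B)] \le \mathrm{tr}(AB),$$ where $\log A$ is the Hermitian logarithm: if $A=\sum_i\lambda_i P_{\lambda_i}$ is the spectral decomposition of $A$, with $\lambda_i>0$ the distinct eigenvalues and $P_{\lambda_i}$ the orthogonal eigenprojections, then $\log A=\sum_i(\log\lambda_i)P_{\lambda_i}$. -/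

import Mathlib

open scoped ComplexOrder

namespace GoldenThompson

open Filter Topology Asymptotics

section LieTrotter

variable {R : Type*} [NormedRing R] [NormOneClass R]

/-! By the Lie product formula, `exp (A + B)` is the limit of `(exp (A/N) * exp (B/N)) ^ N`. Along
`N = 2 ^ k`, `trace_two_pow_re_le` bounds the trace of each term by `tr (exp A * exp B)`, and
continuity of the trace gives the claim. The logarithmic form is the case of `log A` and `log B`. -/

theorem norm_pow_sub_pow_le {x y : R} {M : ℝ} (hM : 1 ≤ M) (hx : ‖x‖ ≤ M) (hy : ‖y‖ ≤ M)
    (n : ℕ) : ‖x ^ n - y ^ n‖ ≤ n * M ^ n * ‖x - y‖ := by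
  induction n with
  | zero => simp
  | succ n ih =>
    have hM0 : 0 ≤ M := zero_le_one.trans hM
    have hxn : ‖x ^ n‖ ≤ M ^ n := (norm_pow_le x n).trans (by gcongr)
    calc ‖x ^ (n + 1) - y ^ (n + 1)‖ = ‖x ^ n * (x - y) + (x ^ n - y ^ n) * y‖ := by
          congr 1; rw [pow_succ, pow_succ]; noncomm_ring
      _ ≤ ‖x ^ n‖ * ‖x - y‖ + ‖x ^ n - y ^ n‖ * ‖y‖ :=
          (norm_add_le _ _).trans (add_le_add (norm_mul_le _ _) (norm_mul_le _ _))
      _ ≤ M ^ n * ‖x - y‖ + n * M ^ n * ‖x - y‖ * M := by gcongr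
      _ ≤ M ^ (n + 1) * ‖x - y‖ + n * M ^ n * ‖x - y‖ * M := by
          gcongr
          exact Nat.le_succ n
      _ = ((n + 1 : ℕ) : ℝ) * M ^ (n + 1) * ‖x - y‖ := by push_cast; ring

variable [NormedAlgebra ℝ R]

theorem eventually_norm_inv_le {f : ℝ → R} {D : R} (hf : HasDerivAt f D 0) (hf1 : f 0 = 1) :
    ∃ C : ℝ, 0 ≤ C ∧ ∀ᶠ n : ℕ in atTop, ‖f ((n : ℝ)⁻¹)‖ ≤ 1 + C / n := by
  obtain ⟨C, hC, h⟩ := hf.isBigO_sub.exists_nonneg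
  refine ⟨C, hC, ?_⟩
  filter_upwards [(tendsto_inv_atTop_nhds_zero_nat (𝕜 := ℝ)).eventually h.bound] with n hn
  have hn' : ‖f ((n : ℝ)⁻¹) - 1‖ ≤ C / n := by simpa [hf1, div_eq_mul_inv] using hn
  calc ‖f ((n : ℝ)⁻¹)‖ = ‖1 + (f ((n : ℝ)⁻¹) - 1)‖ := by congr 1; abel
    _ ≤ ‖(1 : R)‖ + ‖f ((n : ℝ)⁻¹) - 1‖ := norm_add_le _ _
    _ ≤ 1 + C / n := by rw [norm_one]; gcongr

/-- Two curves through `1` with the same velocity at `0` have asymptotic powers `f (1 / n) ^ n`. -/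
theorem tendsto_pow_sub_pow_of_hasDerivAt {f g : ℝ → R} {D : R} (hf : HasDerivAt f D 0)
    (hg : HasDerivAt g D 0) (hf1 : f 0 = 1) (hg1 : g 0 = 1) :
    Tendsto (fun n : ℕ ↦ f ((n : ℝ)⁻¹) ^ n - g ((n : ℝ)⁻¹) ^ n) atTop (𝓝 0) := by
  obtain ⟨C, hC, hfC⟩ := eventually_norm_inv_le hf hf1
  obtain ⟨C', hC', hgC⟩ := eventually_norm_inv_le hg hg1
  -- Equal velocities give `f t - g t = o(t)`, which beats the factor `n` lost in comparing `n`-th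
  -- powers.
  have hd : HasDerivAt (fun t ↦ f t - g t) 0 0 := by
    simpa using hf.fun_sub hg
  have ho := hd.isLittleO
  simp only [hf1, hg1, sub_self, sub_zero, smul_zero] at ho
  rw [Metric.tendsto_atTop']
  intro ε hε
  set K := Real.exp (max C C')
  have hK : 0 < K := Real.exp_pos _
  have hb := (tendsto_inv_atTop_nhds_zero_nat (𝕜 := ℝ)).eventually
    (ho.def (c := ε / (2 * K)) (by positivity))
  obtain ⟨N, hN⟩ := eventually_atTop.1 (hfC.and (hgC.and (hb.and (eventually_gt_atTop 0))))
  refine ⟨N, fun n hn ↦ ?_⟩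
  obtain ⟨h1, h2, h3, hn0⟩ := hN n hn.le
  have hn0' : (0 : ℝ) < n := by exact_mod_cast hn0
  have hM : (1 : ℝ) ≤ 1 + max C C' / n := by
    have : 0 ≤ max C C' / n := by positivity
    linarith
  have hp := norm_pow_sub_pow_le hM (h1.trans (by gcongr; exact le_max_left _ _))
    (h2.trans (by gcongr; exact le_max_right _ _)) n
  have hMK : (1 + max C C' / n) ^ n ≤ K := by
    calc (1 + max C C' / n) ^ n ≤ Real.exp (max C C' / n) ^ n := by
          gcongr
          rw [add_comm]; exact Real.add_one_le_exp _
      _ = K := by rw [← Real.exp_nat_mul]; congr 1; field_simp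
  rw [dist_zero_right]
  rw [norm_inv, Real.norm_natCast] at h3
  calc ‖f ((n : ℝ)⁻¹) ^ n - g ((n : ℝ)⁻¹) ^ n‖
      ≤ n * K * (ε / (2 * K) * (n : ℝ)⁻¹) := hp.trans (by gcongr)
    _ = ε / 2 := by field_simp
    _ < ε := by linarith

/-- The **Lie product formula** in a real Banach algebra. -/
theorem tendsto_exp_mul_exp_pow [CompleteSpace R] (A B : R) :
    Tendsto (fun n : ℕ ↦
      (NormedSpace.exp ((n : ℝ)⁻¹ • A) * NormedSpace.exp ((n : ℝ)⁻¹ • B)) ^ n) atTop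
      (𝓝 (NormedSpace.exp (A + B))) := by
  let : NormedAlgebra ℚ R := .restrictScalars ℚ ℝ R
  have hexp (X : R) : HasDerivAt (fun t : ℝ ↦ NormedSpace.exp (t • X)) X 0 := by
    simpa using hasDerivAt_exp_smul_const (𝕂 := ℝ) X (0 : ℝ)
  have h := tendsto_pow_sub_pow_of_hasDerivAt (D := A + B)
    (f := fun t : ℝ ↦ NormedSpace.exp (t • A) * NormedSpace.exp (t • B))
    (g := fun t : ℝ ↦ NormedSpace.exp (t • (A + B)))
    (by simpa using (hexp A).fun_mul (hexp B)) (hexp (A + B)) (by simp) (by simp)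
  rw [← tendsto_sub_nhds_zero_iff]
  refine h.congr' ?_
  filter_upwards [eventually_gt_atTop 0] with n hn
  have hn' : (n : ℝ) ≠ 0 := by exact_mod_cast hn.ne'
  congr 1
  rw [← NormedSpace.exp_nsmul, ← Nat.cast_smul_eq_nsmul ℝ, smul_smul, mul_inv_cancel₀ hn',
    one_smul]

end LieTrotter

section Trace

open Matrix

variable {n : Type*} [Fintype n]

theorem _root_.Matrix.IsHermitian.trace_im {A : Matrix n n ℂ} (hA : A.IsHermitian) :
    A.trace.im = 0 := by
  rw [← Complex.conj_eq_iff_im, starRingEnd_apply, ← trace_conjTranspose, hA.eq]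

theorem _root_.Matrix.IsHermitian.trace_mul_im {A B : Matrix n n ℂ} (hA : A.IsHermitian)
    (hB : B.IsHermitian) : (A * B).trace.im = 0 := by
  rw [← Complex.conj_eq_iff_im, starRingEnd_apply, ← trace_conjTranspose, conjTranspose_mul, hA.eq,
    hB.eq, trace_mul_comm]

theorem trace_conjTranspose_mul_self_re_nonneg (X : Matrix n n ℂ) :
    0 ≤ (Xᴴ * X).trace.re :=
  (Complex.nonneg_iff.1 (posSemidef_conjTranspose_mul_self X).trace_nonneg).1

variable [DecidableEq n]

theorem trace_mul_pow_comm (M N : Matrix n n ℂ) (k : ℕ) :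
    ((M * N) ^ k).trace = ((N * M) ^ k).trace := by
  cases k with
  | zero => simp
  | succ k =>
    have h : (M * N) ^ k * M = M * (N * M) ^ k :=
      ((show SemiconjBy M (N * M) (M * N) from (mul_assoc M N M).symm).pow_right k).eq.symm
    rw [pow_succ, ← mul_assoc, h, trace_mul_comm, ← mul_assoc, ← pow_succ']

/-- Expand `0 ≤ tr ((X - Xᴴ)ᴴ * (X - Xᴴ))`. -/
theorem trace_sq_re_le (X : Matrix n n ℂ) : (X ^ 2).trace.re ≤ (Xᴴ * X).trace.re := by
  have h := trace_conjTranspose_mul_self_re_nonneg (X - Xᴴ)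
  have h1 : (Xᴴ * Xᴴ).trace.re = (X * X).trace.re := by
    rw [← conjTranspose_mul, trace_conjTranspose]; simp
  have h2 : (X * Xᴴ).trace.re = (Xᴴ * X).trace.re := by rw [trace_mul_comm]
  simp only [conjTranspose_sub, conjTranspose_conjTranspose, sub_mul, mul_sub, trace_sub,
    Complex.sub_re] at h
  rw [sq]
  linarith

theorem trace_mul_re_le {R S : Matrix n n ℂ} (hR : R.IsHermitian) (hS : S.IsHermitian) :
    (R * S).trace.re ≤ ((R ^ 2).trace.re + (S ^ 2).trace.re) / 2 := by
  have h := trace_conjTranspose_mul_self_re_nonneg (R - S)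
  have h2 : (S * R).trace.re = (R * S).trace.re := by rw [trace_mul_comm]
  simp only [conjTranspose_sub, hR.eq, hS.eq, sub_mul, mul_sub, trace_sub, Complex.sub_re] at h
  rw [sq, sq]
  linarith

/-- The two bounds feed each other, hence the joint induction: the first at `k + 1` uses the second
for `P * Q`, then the first for `P ^ 2`, `Q ^ 2`. -/
theorem trace_two_pow_re_le (k : ℕ) :
    (∀ P Q : Matrix n n ℂ, P.IsHermitian → Q.IsHermitian →
      ((P * Q) ^ 2 ^ k).trace.re ≤ (P ^ 2 ^ k * Q ^ 2 ^ k).trace.re) ∧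
    ∀ X : Matrix n n ℂ, (X ^ 2 ^ (k + 1)).trace.re ≤ ((Xᴴ * X) ^ 2 ^ k).trace.re := by
  induction k with
  | zero => exact ⟨by simp, fun X ↦ by simpa using trace_sq_re_le X⟩
  | succ k ih =>
    obtain ⟨ihS, ihL⟩ := ih
    constructor
    · intro P Q hP hQ
      refine (ihL (P * Q)).trans ?_
      have h : (P * Q)ᴴ * (P * Q) = Q * (P ^ 2 * Q) := by
        rw [conjTranspose_mul, hP.eq, hQ.eq]; noncomm_ring
      rw [h, trace_mul_pow_comm, show P ^ 2 * Q * Q = P ^ 2 * Q ^ 2 by noncomm_ring]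
      simpa only [← pow_mul, ← pow_succ'] using ihS (P ^ 2) (Q ^ 2) (hP.pow 2) (hQ.pow 2)
    · intro X
      have hP := isHermitian_conjTranspose_mul_self X
      have hQ := isHermitian_mul_conjTranspose_self X
      -- Cyclicity turns the bound for `X ^ 2` into a power of `(Xᴴ * X) * (X * Xᴴ)`, to which `ihS`
      -- applies.
      have h1 := ihL (X ^ 2)
      rw [← pow_mul, ← pow_succ', show (X ^ 2)ᴴ * X ^ 2 = Xᴴ * (Xᴴ * X * X) by
        rw [conjTranspose_pow]; noncomm_ring, trace_mul_pow_comm,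
        show Xᴴ * X * X * Xᴴ = (Xᴴ * X) * (X * Xᴴ) by noncomm_ring] at h1
      -- The mean of the two squares collapses, as powers of `Xᴴ * X` and `X * Xᴴ` have equal trace.
      have h2 := trace_mul_re_le (hP.pow (2 ^ k)) (hQ.pow (2 ^ k))
      rw [← pow_mul, ← pow_mul, ← pow_succ, trace_mul_pow_comm X Xᴴ] at h2
      linarith [ihS _ _ hP hQ]

open scoped Matrix.Norms.L2Operator in
theorem trace_exp_add_re_le {A B : Matrix n n ℂ} (hA : A.IsHermitian) (hB : B.IsHermitian) :
    (NormedSpace.exp (A + B)).trace.re ≤ (NormedSpace.exp A * NormedSpace.exp B).trace.re := by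
  -- For empty `n` the norm of `1` is `0`, so the Lie formula above does not apply.
  cases isEmpty_or_nonempty n
  · simp [Matrix.trace]
  have hlim := (tendsto_exp_mul_exp_pow A B).comp
    (tendsto_pow_atTop_atTop_of_one_lt (one_lt_two : 1 < 2))
  have hcont : Continuous fun M : Matrix n n ℂ ↦ M.trace.re := by fun_prop
  refine le_of_tendsto ((hcont.tendsto _).comp hlim) (Eventually.of_forall fun k ↦ ?_)
  have hherm {X : Matrix n n ℂ} (hX : X.IsHermitian) :
      (NormedSpace.exp (((2 ^ k : ℕ) : ℝ)⁻¹ • X)).IsHermitian := by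
    apply IsHermitian.exp
    rw [IsHermitian, conjTranspose_smul, hX.eq, star_trivial]
  have hpow (X : Matrix n n ℂ) :
      NormedSpace.exp (((2 ^ k : ℕ) : ℝ)⁻¹ • X) ^ 2 ^ k = NormedSpace.exp X := by
    rw [← Matrix.exp_nsmul, ← Nat.cast_smul_eq_nsmul ℝ, smul_smul,
      mul_inv_cancel₀ (by positivity), one_smul]
  simpa only [Function.comp_apply, hpow] using (trace_two_pow_re_le k).1 _ _ (hherm hA) (hherm hB)

open scoped Matrix.Norms.L2Operator MatrixOrder in
theorem exp_cfc_log {A : Matrix n n ℂ} (hA : A.PosDef) :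
    NormedSpace.exp (cfc Real.log A) = A :=
  CFC.exp_log A hA.isStrictlyPositive

end Trace

end GoldenThompson

theorem mainTheorem1 {n : Type*} [Fintype n] [DecidableEq n] :
    (∀ A B : Matrix n n ℂ, A.IsHermitian → B.IsHermitian →
      (NormedSpace.exp (A + B)).trace.im = 0 ∧
      (NormedSpace.exp A * NormedSpace.exp B).trace.im = 0 ∧
      (NormedSpace.exp (A + B)).trace.re ≤ (NormedSpace.exp A * NormedSpace.exp B).trace.re) ∧
    (∀ A B : Matrix n n ℂ, A.PosDef → B.PosDef →
      (NormedSpace.exp (cfc Real.log A + cfc Real.log B)).trace.im = 0 ∧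
      (A * B).trace.im = 0 ∧
      (NormedSpace.exp (cfc Real.log A + cfc Real.log B)).trace.re ≤ (A * B).trace.re) := by
  have hlog (A : Matrix n n ℂ) : (cfc Real.log A).IsHermitian := cfc_predicate Real.log A
  refine ⟨fun A B hA hB ↦ ⟨(hA.add hB).exp.trace_im, hA.exp.trace_mul_im hB.exp,
    GoldenThompson.trace_exp_add_re_le hA hB⟩, fun A B hA hB ↦
    ⟨((hlog A).add (hlog B)).exp.trace_im, hA.isHermitian.trace_mul_im hB.isHermitian, ?_⟩⟩
  simpa only [GoldenThompson.exp_cfc_log hA, GoldenThompson.exp_cfc_log hB] using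
    GoldenThompson.trace_exp_add_re_le (hlog A) (hlog B)
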